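/- Let $\Bbbk$ be a commutative ring, let $R$ be an associative unital $\Bbbk$-algebra, and let $R$-complexes be homologically graded complexes of left $R$-modules (indexed by $\mathbb{Z}$). For $R$-complexes $X,Y$ let $\operatorname{Hom}_R(X,Y)$ be the complex of $\Bbbk$-modules with $\operatorname{Hom}_R(X,Y)_n=\prod_{j}\operatorname{Hom}_R(X_j,Y_{j+n})$ and differential $\partial(\varphi)=\partial^Y\varphi-(-1)^{|\varphi|}\varphi\,\partial^X$. A complex $P$ of projective modules is semi-projective if $\operatorname{Hom}_R(P,-)$ preserves acyclicity; a complex $I$ of injective modules is semi-injective if $\operatorname{Hom}_R(-,I)$ preserves acyclicity. A complete projective resolution of $M$ is a diagram $T\xrightarrow{\tau}P\xrightarrow{\pi}M$ in which $\pi$ is a quasi-isomorphism, $P$ is semi-projective, $T$ is an acyclic complex of projective modules such that $\operatorname{Hom}_R(T,Q)$ is acyclic for every projective module $Q$, and $\tau_i$ is an isomorphism for all $i\gg 0$. A complete injective resolution of $N$ is a diagram $N\xrightarrow{\iota}I\xrightarrow{\upsilon}U$ in which $\iota$ is a quasi-isomorphism, $I$ is semi-injective, $U$ is an acyclic complex of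 injective modules such that $\operatorname{Hom}_R(J,U)$ is acyclic for every injective module $J$, and $\upsilon_i$ is an isomorphism for all $i\ll 0$. For $M$ with a complete projective resolution $T\to P\to M$, the Tate cohomology of $M$ with coefficients in $N$ is $\widehat{\operatorname{Ext}}{}^i_R(M,N)=H_{-i}(\operatorname{Hom}_R(T,N))$. **Theorem (Tate cohomology is balanced).** Let $M$ be a bounded above $R$-complex (that is, $M_i=0$ for all $i\gg0$) with a complete projective resolution $T\to P\to M$, and let $N$ be a bounded below $R$-complex (that is, $N_i=0$ for all $i\ll0$) with a complete injective resolution $N\to I\to U$. Then for every $i\in\mathbb{Z}$ there is an isomorphism of $\Bbbk$-modules $$\widehat{\operatorname{Ext}}{}^i_R(M,N)=H_{-i}(\operatorname{Hom}_R(T,N))\;\cong\; H_{-i}(\operatorname{Hom}_R(M,U)).$$ -/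

import Mathlib

open CategoryTheory CategoryTheory.Limits

universe u w

/-- An `R`-complex of (left, unitary) modules over an associative unital ring `R`.
In homological grading, an `R`-complex is a family `(M_i)` with differential of degree `-1`; it is
encoded through the usual reindexing `M_i = M.X (-i)` as a cochain complex, so that homology in
homological degree `i` is `M.homology (-i)`. -/
abbrev RComplex (R : Type u) [Ring R] := CochainComplex (ModuleCat.{u} R) ℤ

namespace RComplex

section HomComplex

open scoped ModuleCat.Algebra

/-- The complex of `𝕜`-modules `Hom_R(K, L)`, for a `𝕜`-algebra `R`. It is Mathlib's complex of
abelian groups `CochainComplex.HomComplex K L`, remembering the `𝕜`-module structure: a cochain of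
degree `n` is a family of `R`-linear maps `K^p → L^(p+n)`, and the differential of a cochain `φ` is
`d_L φ - (-1)^n φ d_K`. The homological degree of `φ` is `-n`. -/
noncomputable def homComplex (𝕜 : Type w) [CommRing 𝕜] {R : Type u} [Ring R] [Algebra 𝕜 R]
    (K L : RComplex R) : CochainComplex (ModuleCat.{u} 𝕜) ℤ where
  X n := ModuleCat.of 𝕜 (CochainComplex.HomComplex.Cochain K L n)
  d m n := ModuleCat.ofHom (CochainComplex.HomComplex.δ_hom 𝕜 K L m n)
  shape m n h := ModuleCat.hom_ext <| LinearMap.ext fun φ =>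
    CochainComplex.HomComplex.δ_shape m n h φ
  d_comp_d' l m n _ _ := ModuleCat.hom_ext <| LinearMap.ext fun φ =>
    CochainComplex.HomComplex.δ_δ l m n φ

end HomComplex

variable {R : Type u} [Ring R]

/-- `M_i = 0` for all sufficiently large homological degrees `i`. -/
def BoundedAbove (M : RComplex R) : Prop :=
  ∃ s : ℤ, ∀ i : ℤ, s < i → IsZero (M.X (-i))

/-- `M_i = 0` for all sufficiently small homological degrees `i`. -/
def BoundedBelow (M : RComplex R) : Prop :=
  ∃ s : ℤ, ∀ i : ℤ, i < s → IsZero (M.X (-i))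

/-- `P` is semi-projective: a complex of projective modules such that `Hom(P, -)` preserves
acyclicity (equivalently, preserves quasi-isomorphisms). -/
structure IsSemiprojective (P : RComplex R) : Prop where
  projective : ∀ i : ℤ, Module.Projective R (P.X i)
  acyclic_hom : ∀ X : RComplex R, X.Acyclic → (CochainComplex.HomComplex P X).Acyclic

/-- `I` is semi-injective: a complex of injective modules such that `Hom(-, I)` preserves
acyclicity (equivalently, preserves quasi-isomorphisms). -/
structure IsSemiinjective (I : RComplex R) : Prop where
  injective : ∀ i : ℤ, Module.Injective R (I.X i)
  acyclic_hom : ∀ X : RComplex R, X.Acyclic → (CochainComplex.HomComplex X I).Acyclic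

/-- A module, viewed as a complex concentrated in degree `0`. -/
noncomputable abbrev ofModule (Q : ModuleCat.{u} R) : RComplex R :=
  (HomologicalComplex.single (ModuleCat.{u} R) (ComplexShape.up ℤ) 0).obj Q

/-- `T` is a totally acyclic complex of projective modules. -/
structure IsTotallyAcyclicProjective (T : RComplex R) : Prop where
  projective : ∀ i : ℤ, Module.Projective R (T.X i)
  acyclic : T.Acyclic
  acyclic_hom : ∀ Q : ModuleCat.{u} R, Module.Projective R Q →
    (CochainComplex.HomComplex T (ofModule Q)).Acyclic

/-- `U` is a totally acyclic complex of injective modules. -/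
structure IsTotallyAcyclicInjective (U : RComplex R) : Prop where
  injective : ∀ i : ℤ, Module.Injective R (U.X i)
  acyclic : U.Acyclic
  acyclic_hom : ∀ J : ModuleCat.{u} R, Module.Injective R J →
    (CochainComplex.HomComplex (ofModule J) U).Acyclic

/-- A complete projective resolution `T ⟶ P ⟶ M`: `P ⟶ M` is a semi-projective resolution, `T` is
a totally acyclic complex of projective modules, and `T_i ⟶ P_i` is an isomorphism for all
sufficiently large homological degrees `i`. -/
structure CompleteProjectiveResolution (M : RComplex R) where
  T : RComplex R
  P : RComplex R
  τ : T ⟶ P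
  π : P ⟶ M
  totallyAcyclic : IsTotallyAcyclicProjective T
  semiprojective : IsSemiprojective P
  quasiIso : QuasiIso π
  isIso_τ : ∃ n : ℤ, ∀ i : ℤ, n ≤ i → IsIso (τ.f (-i))

/-- A complete injective resolution `N ⟶ I ⟶ U`: `N ⟶ I` is a semi-injective resolution, `U` is
a totally acyclic complex of injective modules, and `I_i ⟶ U_i` is an isomorphism for all
sufficiently small homological degrees `i`. -/
structure CompleteInjectiveResolution (N : RComplex R) where
  I : RComplex R
  U : RComplex R
  ι : N ⟶ I
  υ : I ⟶ U
  totallyAcyclic : IsTotallyAcyclicInjective U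
  semiinjective : IsSemiinjective I
  quasiIso : QuasiIso ι
  isIso_υ : ∃ n : ℤ, ∀ i : ℤ, i ≤ n → IsIso (υ.f (-i))

/-- The `i`-th Tate cohomology `𝕜`-module of `M` with coefficients in `N`, computed from a complete
projective resolution `T ⟶ P ⟶ M`: the homology of `Hom(T, N)` in homological degree `-i`, that is,
in cohomological degree `i`. -/
noncomputable def tateExt (𝕜 : Type w) [CommRing 𝕜] [Algebra 𝕜 R] {M : RComplex R}
    (C : CompleteProjectiveResolution M) (N : RComplex R) (i : ℤ) : ModuleCat.{u} 𝕜 :=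
  (homComplex 𝕜 C.T N).homology i

end RComplex

namespace RComplex

open CochainComplex CochainComplex.HomComplex
open scoped ModuleCat.Algebra

variable (𝕜 : Type w) [CommRing 𝕜] {R : Type u} [Ring R] [Algebra 𝕜 R]

/-- The chain map `Hom(K, L) ⟶ Hom(K, L')` given by composition with `f : L ⟶ L'`. -/
noncomputable def postcomp (K : RComplex R) {L L' : RComplex R} (f : L ⟶ L') :
    homComplex 𝕜 K L ⟶ homComplex 𝕜 K L' where
  f n := ModuleCat.ofHom
    { toFun := fun φ => φ.comp (Cochain.ofHom f) (add_zero n)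
      map_add' := fun _ _ => Cochain.add_comp _ _ _ _
      map_smul' := fun _ _ => Cochain.smul_comp _ _ _ _ }
  comm' _ n _ := ModuleCat.hom_ext <| LinearMap.ext fun φ => δ_comp_ofHom φ f n

/-- The chain map `Hom(K', L) ⟶ Hom(K, L)` given by composition with `f : K ⟶ K'`. -/
noncomputable def precomp {K K' : RComplex R} (f : K ⟶ K') (L : RComplex R) :
    homComplex 𝕜 K' L ⟶ homComplex 𝕜 K L where
  f n := ModuleCat.ofHom
    { toFun := fun φ => (Cochain.ofHom f).comp φ (zero_add n)
      map_add' := fun _ _ => Cochain.comp_add _ _ _ _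
      map_smul' := fun _ _ => Cochain.comp_smul _ _ _ _ }
  comm' _ n _ := ModuleCat.hom_ext <| LinearMap.ext fun φ => δ_ofHom_comp f φ n

lemma postcomp_id (K L : RComplex R) : postcomp 𝕜 K (𝟙 L) = 𝟙 _ := by
  ext n φ
  exact Cochain.comp_id φ

lemma postcomp_comp (K : RComplex R) {L L' L'' : RComplex R} (f : L ⟶ L') (g : L' ⟶ L'') :
    postcomp 𝕜 K (f ≫ g) = postcomp 𝕜 K f ≫ postcomp 𝕜 K g := by
  ext n φ
  exact (congrArg (Cochain.comp φ · (add_zero n)) (Cochain.ofHom_comp f g)).trans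
    (Cochain.comp_assoc_of_second_is_zero_cochain (z₁ := φ) ..).symm

lemma precomp_id (K L : RComplex R) : precomp 𝕜 (𝟙 K) L = 𝟙 _ := by
  ext n φ
  exact Cochain.id_comp φ

lemma precomp_comp {K K' K'' : RComplex R} (f : K ⟶ K') (g : K' ⟶ K'') (L : RComplex R) :
    precomp 𝕜 (f ≫ g) L = precomp 𝕜 g L ≫ precomp 𝕜 f L := by
  ext n φ
  exact (congrArg (Cochain.comp · φ (zero_add n)) (Cochain.ofHom_comp f g)).trans
    (Cochain.comp_assoc_of_first_is_zero_cochain (z₃ := φ) ..)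

/-- Isomorphic complexes have isomorphic complexes of homomorphisms into them. -/
noncomputable def postcompIso (K : RComplex R) {L L' : RComplex R} (e : L ≅ L') :
    homComplex 𝕜 K L ≅ homComplex 𝕜 K L' where
  hom := postcomp 𝕜 K e.hom
  inv := postcomp 𝕜 K e.inv
  hom_inv_id := by rw [← postcomp_comp, e.hom_inv_id, postcomp_id]
  inv_hom_id := by rw [← postcomp_comp, e.inv_hom_id, postcomp_id]

/-- Isomorphic complexes have isomorphic complexes of homomorphisms out of them. -/
noncomputable def precompIso {K K' : RComplex R} (e : K ≅ K') (L : RComplex R) :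
    homComplex 𝕜 K' L ≅ homComplex 𝕜 K L where
  hom := precomp 𝕜 e.hom L
  inv := precomp 𝕜 e.inv L
  hom_inv_id := by rw [← precomp_comp, e.inv_hom_id, precomp_id]
  inv_hom_id := by rw [← precomp_comp, e.hom_inv_id, precomp_id]

/-- `Hom(K, L)[1] ≅ Hom(K, L[1])`. -/
noncomputable def homComplexShiftRightIso (K L : RComplex R) :
    (homComplex 𝕜 K L)⟦(1 : ℤ)⟧ ≅ homComplex 𝕜 K (L⟦(1 : ℤ)⟧) :=
  HomologicalComplex.Hom.isoOfComponents
    (fun n => (Cochain.rightShiftLinearEquiv 𝕜 K L (n + 1) 1 n rfl).toModuleIso)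
    fun m n _ => ModuleCat.hom_ext <| LinearMap.ext fun (φ : Cochain K L (m + 1)) =>
      (Cochain.δ_rightShift φ 1 m n rfl (n + 1) rfl).trans
        (Cochain.rightShift_units_smul (δ (m + 1) (n + 1) φ) 1 n rfl _).symm

/-- `Hom(K, L) ≅ Hom(K[1], L)[1]`. -/
noncomputable def homComplexShiftLeftIso (K L : RComplex R) :
    homComplex 𝕜 K L ≅ (homComplex 𝕜 (K⟦(1 : ℤ)⟧) L)⟦(1 : ℤ)⟧ :=
  HomologicalComplex.Hom.isoOfComponents
    (fun n => (Cochain.leftShiftLinearEquiv 𝕜 K L n 1 (n + 1) rfl).toModuleIso)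
    fun m n _ => ModuleCat.hom_ext <| LinearMap.ext fun (φ : Cochain K L m) => by
      refine (congrArg (Int.negOnePow 1 • ·)
        (Cochain.δ_leftShift φ 1 (m + 1) (n + 1) rfl n rfl)).trans ?_
      exact (smul_smul _ _ _).trans
        ((congrArg (· • _) (Int.units_mul_self (Int.negOnePow 1))).trans (one_smul _ _))

/-- `H^i Hom(K, L[1]) ≅ H^{i+1} Hom(K, L)`. -/
noncomputable def homologyShiftRightIso (K L : RComplex R) (i j : ℤ) (hij : i + 1 = j) :
    (homComplex 𝕜 K (L⟦(1 : ℤ)⟧)).homology i ≅ (homComplex 𝕜 K L).homology j :=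
  (HomologicalComplex.homologyFunctor _ _ i).mapIso (homComplexShiftRightIso 𝕜 K L).symm ≪≫
    (ShiftSequence.shiftIso _ 1 i j (by omega)).app _

/-- `H^i Hom(K, L) ≅ H^{i+1} Hom(K[1], L)`. -/
noncomputable def homologyShiftLeftIso (K L : RComplex R) (i j : ℤ) (hij : i + 1 = j) :
    (homComplex 𝕜 K L).homology i ≅ (homComplex 𝕜 (K⟦(1 : ℤ)⟧) L).homology j :=
  (HomologicalComplex.homologyFunctor _ _ i).mapIso (homComplexShiftLeftIso 𝕜 K L) ≪≫
    (ShiftSequence.shiftIso _ 1 i j (by omega)).app _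

/-- `Hom(K, -)` applied to a short complex of complexes. -/
noncomputable abbrev postcompShortComplex (K : RComplex R) (S : ShortComplex (RComplex R)) :
    ShortComplex (CochainComplex (ModuleCat.{u} 𝕜) ℤ) :=
  ShortComplex.mk (postcomp 𝕜 K S.f) (postcomp 𝕜 K S.g) (by
    rw [← postcomp_comp, S.zero]
    ext n φ
    exact (congrArg (Cochain.comp φ · (add_zero n)) (Cochain.ofHom_zero _ _)).trans
      (Cochain.comp_zero φ _))

/-- `Hom(-, L)` applied to a short complex of complexes. -/
noncomputable abbrev precompShortComplex (S : ShortComplex (RComplex R)) (L : RComplex R) :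
    ShortComplex (CochainComplex (ModuleCat.{u} 𝕜) ℤ) :=
  ShortComplex.mk (precomp 𝕜 S.g L) (precomp 𝕜 S.f L) (by
    rw [← precomp_comp, S.zero]
    ext n φ
    exact (congrArg (Cochain.comp · φ (zero_add n)) (Cochain.ofHom_zero _ _)).trans
      (Cochain.zero_comp φ _))

/-- `Hom(K, -)` is exact when `K` consists of projective modules. -/
lemma shortExact_postcomp (K : RComplex R) [∀ i, Projective (K.X i)]
    {S : ShortComplex (RComplex R)} (hS : S.ShortExact) :
    (postcompShortComplex 𝕜 K S).ShortExact := by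
  have hS' (p : ℤ) := hS.map_of_exact (HomologicalComplex.eval (ModuleCat.{u} R) _ p)
  have (p : ℤ) : Mono (S.f.f p) := (hS' p).mono_f
  have (p : ℤ) : Epi (S.g.f p) := (hS' p).epi_g
  refine HomologicalComplex.shortExact_of_degreewise_shortExact _ fun n => ?_
  refine ShortComplex.ShortExact.mk' ?_ ?_ ?_
  · rw [ShortComplex.moduleCat_exact_iff]
    intro (φ : Cochain K S.X₂ n) (hφ : φ.comp (Cochain.ofHom S.g) (add_zero n) = 0)
    have h (p q : ℤ) (hpq : p + n = q) : φ.v p q hpq ≫ S.g.f q = 0 := by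
      simpa using Cochain.congr_v hφ p q hpq
    have (q : ℤ) : Mono (S.map (HomologicalComplex.eval (ModuleCat R) _ q)).f := (hS' q).mono_f
    have h' (p q : ℤ) (hpq : p + n = q) :
        ∃ l : K.X p ⟶ S.X₁.X q, l ≫ S.f.f q = φ.v p q hpq :=
      ⟨(hS' q).exact.lift (φ.v p q hpq) (h p q hpq), (hS' q).exact.lift_f _ _⟩
    choose l hl using h'
    have hl' : (Cochain.mk l).comp (Cochain.ofHom S.f) (add_zero n) = φ :=
      Cochain.ext _ _ fun p q hpq => by simp [hl]
    exact ⟨Cochain.mk l, hl'⟩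
  · rw [ModuleCat.mono_iff_injective, injective_iff_map_eq_zero]
    intro (φ : Cochain K S.X₁ n) (hφ : φ.comp (Cochain.ofHom S.f) (add_zero n) = 0)
    have h : φ = 0 := Cochain.ext _ _ fun p q hpq => by
      rw [← cancel_mono (S.f.f q), Cochain.zero_v, zero_comp]
      simpa using Cochain.congr_v hφ p q hpq
    exact h
  · rw [ModuleCat.epi_iff_surjective]
    intro (φ : Cochain K S.X₃ n)
    refine ⟨Cochain.mk fun p q hpq => Projective.factorThru (φ.v p q hpq) (S.g.f q), ?_⟩
    refine Cochain.ext _ _ fun p q hpq => ?_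
    refine (Cochain.comp_zero_cochain_v _ _ p q hpq).trans ?_
    rw [Cochain.ofHom_v, Cochain.mk_v]
    exact Projective.factorThru_comp _ _

/-- `Hom(-, L)` is exact when `L` consists of injective modules. -/
lemma shortExact_precomp {S : ShortComplex (RComplex R)} (hS : S.ShortExact)
    (L : RComplex R) [∀ i, Injective (L.X i)] :
    (precompShortComplex 𝕜 S L).ShortExact := by
  have hS' (p : ℤ) := hS.map_of_exact (HomologicalComplex.eval (ModuleCat.{u} R) _ p)
  have (p : ℤ) : Mono (S.f.f p) := (hS' p).mono_f
  have (p : ℤ) : Epi (S.g.f p) := (hS' p).epi_g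
  refine HomologicalComplex.shortExact_of_degreewise_shortExact _ fun n => ?_
  refine ShortComplex.ShortExact.mk' ?_ ?_ ?_
  · rw [ShortComplex.moduleCat_exact_iff]
    intro (φ : Cochain S.X₂ L n) (hφ : (Cochain.ofHom S.f).comp φ (zero_add n) = 0)
    have h (p q : ℤ) (hpq : p + n = q) : S.f.f p ≫ φ.v p q hpq = 0 := by
      simpa using Cochain.congr_v hφ p q hpq
    have (p : ℤ) : Epi (S.map (HomologicalComplex.eval (ModuleCat R) _ p)).g := (hS' p).epi_g
    have h' (p q : ℤ) (hpq : p + n = q) :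
        ∃ l : S.X₃.X p ⟶ L.X q, S.g.f p ≫ l = φ.v p q hpq :=
      ⟨(hS' p).exact.desc (φ.v p q hpq) (h p q hpq), (hS' p).exact.g_desc _ _⟩
    choose l hl using h'
    have hl' : (Cochain.ofHom S.g).comp (Cochain.mk l) (zero_add n) = φ :=
      Cochain.ext _ _ fun p q hpq => by simp [hl]
    exact ⟨Cochain.mk l, hl'⟩
  · rw [ModuleCat.mono_iff_injective, injective_iff_map_eq_zero]
    intro (φ : Cochain S.X₃ L n) (hφ : (Cochain.ofHom S.g).comp φ (zero_add n) = 0)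
    have h : φ = 0 := Cochain.ext _ _ fun p q hpq => by
      rw [← cancel_epi (S.g.f p), Cochain.zero_v, comp_zero]
      simpa using Cochain.congr_v hφ p q hpq
    exact h
  · rw [ModuleCat.epi_iff_surjective]
    intro (φ : Cochain S.X₁ L n)
    refine ⟨Cochain.mk fun p q hpq => Injective.factorThru (φ.v p q hpq) (S.f.f p), ?_⟩
    refine Cochain.ext _ _ fun p q hpq => ?_
    refine (Cochain.zero_cochain_comp_v _ _ p q hpq).trans ?_
    rw [Cochain.ofHom_v, Cochain.mk_v]
    exact Injective.comp_factorThru _ _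

end RComplex

namespace RComplex

open CochainComplex CochainComplex.HomComplex
open scoped ModuleCat.Algebra

variable (𝕜 : Type w) [CommRing 𝕜] {R : Type u} [Ring R] [Algebra 𝕜 R]

lemma homComplex_acyclic_iff (K L : RComplex R) :
    (homComplex 𝕜 K L).Acyclic ↔
      ∀ (l m n : ℤ) (_ : l + 1 = m) (_ : m + 1 = n) (φ : Cochain K L m), δ m n φ = 0 →
        ∃ ψ : Cochain K L l, δ l m ψ = φ := by
  refine ⟨fun h l m n hlm hmn φ hφ => ?_, fun h m => ?_⟩
  · have := (HomologicalComplex.exactAt_iff' _ l m n (by simp; omega) (by simp; omega)).1 (h m)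
    exact (ShortComplex.moduleCat_exact_iff _).1 this φ hφ
  · rw [HomologicalComplex.exactAt_iff' _ (m - 1) m (m + 1) (by simp) (by simp),
      ShortComplex.moduleCat_exact_iff]
    exact h (m - 1) m (m + 1) (by omega) rfl

lemma homComplex_acyclic_of_acyclic {K L : RComplex R} (h : (HomComplex K L).Acyclic) :
    (homComplex 𝕜 K L).Acyclic := by
  rw [homComplex_acyclic_iff]
  intro l m n hlm hmn φ hφ
  have := (HomologicalComplex.exactAt_iff' _ l m n (by simp; omega) (by simp; omega)).1 (h m)
  exact (ShortComplex.ab_exact_iff _).1 this φ hφ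

/-- `Hom(K, L)` is acyclic if all morphisms to shifts of `L` are homotopic to zero. -/
lemma homComplex_acyclic_of_homotopy {K L : RComplex R}
    (h : ∀ (n : ℤ) (f : K ⟶ L⟦n⟧), Nonempty (Homotopy f 0)) : (homComplex 𝕜 K L).Acyclic := by
  rw [homComplex_acyclic_iff]
  intro l m n hlm hmn φ hφ
  obtain ⟨f, hf⟩ := (Cocycle.equivHom K (L⟦m⟧)).surjective
    ((Cocycle.mk φ n hmn hφ).rightShift m 0 (zero_add m))
  obtain ⟨⟨β, hβ⟩⟩ := (h m f).map (Cochain.equivHomotopy _ _)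
  rw [Cochain.ofHom_zero, add_zero] at hβ
  have hf' : Cochain.ofHom f = φ.rightShift m 0 (zero_add m) := congrArg Subtype.val hf
  refine ⟨m.negOnePow • Cochain.rightUnshift β l (by omega), ?_⟩
  rw [δ_units_smul, Cochain.δ_rightUnshift β l (by omega) m 0 (by omega), ← hβ, hf', smul_smul,
    Int.units_mul_self, one_smul, Cochain.rightUnshift_rightShift]

end RComplex

namespace CochainComplex

open HomComplex Cochain.InductionUp

variable {C : Type*} [Category* C] [Abelian C]

/-- A morphism from a bounded below acyclic complex to a complex of injective objects is
homotopic to zero. -/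
lemma nonempty_homotopy_zero_of_injective {K L : CochainComplex C ℤ} (f : K ⟶ L) (d : ℤ)
    [K.IsStrictlyGE d] [∀ n, Injective (L.X n)] (hK : K.Acyclic) :
    Nonempty (Homotopy f 0) := by
  let X (n : ℕ) : Set (Cochain K L (-1)) :=
    Set.ofPred (fun α => (δ (-1) 0 α).EqUpTo (Cochain.ofHom f) (n + d - 1))
  let x₀ : X 0 := ⟨0, fun p q hpq hp =>
    IsZero.eq_of_src (K.isZero_of_isStrictlyGE d _ (by lia)) _ _⟩
  let φ (n : ℕ) (α : X n) : X (n + 1) :=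
    ⟨_, (isKInjective_of_injective_aux f α.1 (n + d - 1) ((n + 1 : ℕ) + d - 1)
      (by lia) (hK _) α.2).choose_spec⟩
  have hφ (k : ℕ) (x : X k) : (φ k x).1.EqUpTo x.1 (d + k) := fun p q hpq hp => by
    dsimp [φ]
    rw [add_eq_left, Cochain.single_v_eq_zero _ _ _ _ _ (by lia)]
  refine ⟨(Cochain.equivHomotopy f 0).symm ⟨limitSequence φ hφ x₀, ?_⟩⟩
  rw [Cochain.ofHom_zero, add_zero]
  ext n
  let k₀ := (n - d + 1).toNat
  rw [← (sequence φ x₀ k₀).2 n n (add_zero n) (by lia),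
    δ_v (-1) 0 (neg_add_cancel 1) _ n n (by lia) (n - 1) (n + 1) rfl (by lia),
    δ_v (-1) 0 (neg_add_cancel 1) _ n n (by lia) (n - 1) (n + 1) rfl (by lia),
    limitSequence_eqUpTo φ hφ x₀ k₀ n (n - 1) (by lia) (by lia),
    limitSequence_eqUpTo φ hφ x₀ k₀ (n + 1) n (by lia) (by lia)]

/-- A morphism from a complex of projective objects to a bounded above acyclic complex is
homotopic to zero. -/
lemma nonempty_homotopy_zero_of_projective {K L : CochainComplex C ℤ} (f : K ⟶ L) (d : ℤ)
    [L.IsStrictlyLE d] [∀ n, Projective (K.X n)] (hL : L.Acyclic) :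
    Nonempty (Homotopy f 0) := by
  have (n : ℤ) : Injective (((opEquivalence C).functor.obj (Opposite.op K)).X n) :=
    inferInstanceAs (Injective (Opposite.op (K.X (-n))))
  have : ((opEquivalence C).functor.obj (Opposite.op L)).IsStrictlyGE (-d) := by
    rw [isStrictlyGE_iff]
    intro i hi
    exact (L.isZero_of_isStrictlyLE d (-i) (by lia)).op
  exact (nonempty_homotopy_zero_of_injective ((opEquivalence C).functor.map f.op) (-d)
    (acyclic_op hL)).map fun h => homotopyUnop (h.trans (.ofEq (by ext; rfl)))

/-- The mapping cone of a quasi-isomorphism is acyclic. -/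
lemma acyclic_mappingCone {K L : CochainComplex C ℤ} (f : K ⟶ L) [QuasiIso f] :
    (mappingCone f).Acyclic := by
  rw [← HomotopyCategory.quotient_obj_mem_subcategoryAcyclic_iff_acyclic]
  refine ((HomotopyCategory.subcategoryAcyclic C).trW_iff_of_distinguished _
    (HomotopyCategory.mappingCone_triangleh_distinguished f)).1 ?_
  rw [← HomotopyCategory.quasiIso_eq_trW_subcategoryAcyclic]
  exact (HomotopyCategory.quotient_map_mem_quasiIso_iff f).2
    ((HomologicalComplex.mem_quasiIso_iff f).2 inferInstance)

lemma isZero_mappingCone_X {K L : CochainComplex C ℤ} (f : K ⟶ L) (i : ℤ)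
    (hK : IsZero (K.X (i + 1))) (hL : IsZero (L.X i)) : IsZero ((mappingCone f).X i) := by
  rw [IsZero.iff_id_eq_zero]
  exact mappingCone.ext_to f i (i + 1) rfl (hK.eq_of_tgt _ _) (hL.eq_of_tgt _ _)

lemma shortExact_triangleRotateShortComplex {K L : CochainComplex C ℤ} (f : K ⟶ L) :
    (mappingCone.triangleRotateShortComplex f).ShortExact :=
  HomologicalComplex.shortExact_of_degreewise_shortExact _
    fun n => (mappingCone.triangleRotateShortComplexSplitting f n).shortExact

lemma acyclic_shift {K : CochainComplex C ℤ} (hK : K.Acyclic) (n : ℤ) : (K⟦n⟧).Acyclic := by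
  intro i
  rw [HomologicalComplex.exactAt_iff_isZero_homology]
  exact ((HomologicalComplex.exactAt_iff_isZero_homology _ _).1 (hK (n + i))).of_iso
    ((ShiftSequence.shiftIso C n i (n + i) rfl).app K)

end CochainComplex
namespace RComplex

open CochainComplex CochainComplex.HomComplex
open scoped ModuleCat.Algebra

variable (𝕜 : Type w) [CommRing 𝕜] {R : Type u} [Ring R] [Algebra 𝕜 R]

lemma homComplex_acyclic_of_projective (K L : RComplex R) [∀ i, Projective (K.X i)] (d : ℤ)
    [L.IsStrictlyLE d] (hL : L.Acyclic) : (homComplex 𝕜 K L).Acyclic :=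
  homComplex_acyclic_of_homotopy 𝕜 fun n f =>
    have := L.isStrictlyLE_shift d n (d - n) (by omega)
    nonempty_homotopy_zero_of_projective f (d - n) (acyclic_shift hL n)

lemma homComplex_acyclic_of_injective (K L : RComplex R) [∀ i, Injective (L.X i)] (d : ℤ)
    [K.IsStrictlyGE d] (hK : K.Acyclic) : (homComplex 𝕜 K L).Acyclic :=
  homComplex_acyclic_of_homotopy 𝕜 fun n f =>
    have (i : ℤ) : Injective ((L⟦n⟧).X i) := inferInstanceAs (Injective (L.X (i + n)))
    nonempty_homotopy_zero_of_injective f d hK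

end RComplex

namespace HomologicalComplex

variable {ι ι' : Type*} {c : ComplexShape ι} {c' : ComplexShape ι'} {C : Type*} [Category* C]
  [Abelian C] {K L : HomologicalComplex C c'} (φ : K ⟶ L) (e : c.Embedding c')

lemma isIso_πTruncGE_f [e.IsTruncGE] {i : ι} {i' : ι'} (hi' : e.f i = i')
    (hi : ¬ e.BoundaryGE i) : IsIso ((K.πTruncGE e).f i') :=
  (e.isIso_liftExtend_f_iff _ _ hi').2 (K.isIso_restrictionToTruncGE' e i hi)

lemma isIso_ιTruncLE_f [e.IsTruncLE] {i : ι} {i' : ι'} (hi' : e.f i = i')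
    (hi : ¬ e.BoundaryLE i) : IsIso ((K.ιTruncLE e).f i') :=
  have : IsIso ((K.op.πTruncGE e.op).f i') := isIso_πTruncGE_f e.op hi' (by simpa using hi)
  inferInstanceAs (IsIso ((K.op.πTruncGE e.op).f i').unop)

lemma isIso_truncGEMap_f [e.IsTruncGE] {i : ι} {i' : ι'} (hi' : e.f i = i')
    (h : IsIso (φ.f i')) (h' : Epi (φ.f (c'.prev i'))) : IsIso ((truncGEMap φ e).f i') := by
  by_cases hi : e.BoundaryGE i
  · have : IsIso (opcyclesMap φ i') :=
      ShortComplex.isIso_opcyclesMap_of_isIso_of_epi' _ h h'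
    have : IsIso ((truncGE'Map φ e).f i) := by
      rw [truncGE'Map_f_eq_opcyclesMap φ e hi hi']
      infer_instance
    have h₁ : IsIso ((extendMap (truncGE'Map φ e) e).f i') := by
      rw [extendMap_f _ e hi']
      infer_instance
    exact h₁
  · have h₁ : IsIso ((K.πTruncGE e).f i') := isIso_πTruncGE_f e hi' hi
    have h₂ : IsIso ((L.πTruncGE e).f i') := isIso_πTruncGE_f e hi' hi
    have h₃ := congr_hom (πTruncGE_naturality φ e) i'
    rw [comp_f, comp_f] at h₃
    exact (isIso_comp_left_iff ((K.πTruncGE e).f i') _).1 (by rw [h₃]; infer_instance)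

lemma isIso_truncLEMap_f [e.IsTruncLE] {i : ι} {i' : ι'} (hi' : e.f i = i')
    (h : IsIso (φ.f i')) (h' : Mono (φ.f (c'.next i'))) : IsIso ((truncLEMap φ e).f i') :=
  have : IsIso ((truncGEMap ((opFunctor C c').map φ.op) e.op).f i') :=
    isIso_truncGEMap_f _ e.op hi' (inferInstanceAs (IsIso (φ.f i').op))
      (inferInstanceAs (Epi (φ.f (c'.next i')).op))
  inferInstanceAs (IsIso ((truncGEMap ((opFunctor C c').map φ.op) e.op).f i').unop)

end HomologicalComplex

namespace CochainComplex

variable {C : Type*} [Category* C] [Abelian C] {K L : CochainComplex C ℤ} (φ : K ⟶ L) (n : ℤ)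

lemma isIso_πTruncGE_f (K : CochainComplex C ℤ) (i : ℤ) (hi : n < i) :
    IsIso ((K.πTruncGE n).f i) := by
  obtain ⟨k, rfl⟩ := Int.le.dest hi.le
  exact HomologicalComplex.isIso_πTruncGE_f _ rfl
    (by rw [ComplexShape.boundaryGE_embeddingUpIntGE_iff]; omega)

lemma isIso_ιTruncLE_f (K : CochainComplex C ℤ) (i : ℤ) (hi : i < n) :
    IsIso ((K.ιTruncLE n).f i) := by
  obtain ⟨k, rfl⟩ := Int.le.dest hi.le
  exact HomologicalComplex.isIso_ιTruncLE_f (i := k) _ (by simp)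
    (by rw [ComplexShape.boundaryLE_embeddingUpIntLE_iff]; omega)

lemma isIso_truncGEMap_f (i : ℤ) (hi : i ≤ n) (h : ∀ j ≤ n, IsIso (φ.f j)) :
    IsIso ((truncGEMap φ n).f i) := by
  obtain hi | rfl := hi.lt_or_eq
  · exact ((K.truncGE n).isZero_of_isStrictlyGE n i hi).isIso
      ((L.truncGE n).isZero_of_isStrictlyGE n i hi) _
  · have := h (i - 1) (by omega)
    exact HomologicalComplex.isIso_truncGEMap_f φ _ (i := 0) (by simp) (h i le_rfl)
      (by rw [CochainComplex.prev]; infer_instance)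

lemma isIso_truncLEMap_f (i : ℤ) (hi : n ≤ i) (h : ∀ j ≥ n, IsIso (φ.f j)) :
    IsIso ((truncLEMap φ n).f i) := by
  obtain hi | rfl := hi.lt_or_eq
  · exact ((K.truncLE n).isZero_of_isStrictlyLE n i hi).isIso
      ((L.truncLE n).isZero_of_isStrictlyLE n i hi) _
  · have := h (n + 1) (by omega)
    exact HomologicalComplex.isIso_truncLEMap_f φ _ (i := 0) (by simp) (h n le_rfl)
      (by rw [CochainComplex.next]; infer_instance)

/-- The quotient of a complex by its canonical truncation `≤ n`. -/
noncomputable abbrev truncLEShortComplex (K : CochainComplex C ℤ) (n : ℤ) :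
    ShortComplex (CochainComplex C ℤ) :=
  ShortComplex.mk (K.ιTruncLE n) (cokernel.π _) (cokernel.condition _)

/-- The kernel of the projection of a complex to its canonical truncation `≥ n`. -/
noncomputable abbrev truncGEShortComplex (K : CochainComplex C ℤ) (n : ℤ) :
    ShortComplex (CochainComplex C ℤ) :=
  ShortComplex.mk (kernel.ι (K.πTruncGE n)) (K.πTruncGE n) (kernel.condition _)

lemma shortExact_truncLEShortComplex (K : CochainComplex C ℤ) (n : ℤ) :
    (K.truncLEShortComplex n).ShortExact :=
  have : Mono (K.ιTruncLE n) := inferInstanceAs (Mono (HomologicalComplex.ιTruncLE K _))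
  .mk' (ShortComplex.exact_cokernel _) this inferInstance

lemma shortExact_truncGEShortComplex (K : CochainComplex C ℤ) (n : ℤ) :
    (K.truncGEShortComplex n).ShortExact :=
  have : Epi (K.πTruncGE n) := inferInstanceAs (Epi (HomologicalComplex.πTruncGE K _))
  .mk' (ShortComplex.exact_kernel _) inferInstance this

end CochainComplex

namespace CategoryTheory.ShortComplex.ShortExact

variable {C : Type*} [Category* C] [Abelian C] {S S' : ShortComplex C}

lemma isIso_τ₃ (hS : S.ShortExact) (hS' : S'.ShortExact) (φ : S ⟶ S') (_ : IsIso φ.τ₁)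
    (_ : IsIso φ.τ₂) : IsIso φ.τ₃ := by
  have := hS.epi_g
  have := hS'.epi_g
  have h : S.f ≫ φ.τ₂ = φ.τ₁ ≫ S'.f := φ.comm₁₂.symm
  refine ⟨hS'.exact.desc (inv φ.τ₂ ≫ S.g) ?_, ?_, ?_⟩
  · rw [← cancel_epi φ.τ₁, ← reassoc_of% h, IsIso.hom_inv_id_assoc, S.zero, comp_zero]
  · rw [← cancel_epi S.g, ← φ.comm₂₃_assoc, hS'.exact.g_desc, IsIso.hom_inv_id_assoc,
      Category.comp_id]
  · rw [← cancel_epi S'.g, hS'.exact.g_desc_assoc, Category.assoc, ← φ.comm₂₃,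
      IsIso.inv_hom_id_assoc, Category.comp_id]

lemma isIso_τ₁ (hS : S.ShortExact) (hS' : S'.ShortExact) (φ : S ⟶ S') (_ : IsIso φ.τ₂)
    (_ : IsIso φ.τ₃) : IsIso φ.τ₁ := by
  have := hS.mono_f
  have := hS'.mono_f
  have h : φ.τ₂ ≫ S'.g = S.g ≫ φ.τ₃ := φ.comm₂₃
  refine ⟨hS.exact.lift (S'.f ≫ inv φ.τ₂) ?_, ?_, ?_⟩
  · rw [← cancel_mono φ.τ₃, Category.assoc, Category.assoc, ← h, IsIso.inv_hom_id_assoc,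
      S'.zero, zero_comp]
  · rw [← cancel_mono S.f, Category.assoc, hS.exact.lift_f, φ.comm₁₂_assoc, IsIso.hom_inv_id,
      Category.comp_id, Category.id_comp]
  · rw [← cancel_mono S'.f, Category.assoc, φ.comm₁₂, hS.exact.lift_f_assoc, Category.assoc,
      IsIso.inv_hom_id, Category.comp_id, Category.id_comp]

end CategoryTheory.ShortComplex.ShortExact

namespace CochainComplex

variable {C : Type*} [Category* C] [Abelian C]

/-- The morphism induced on the quotients by the canonical truncations `≤ n`. -/
noncomputable abbrev truncLEShortComplexMap {K L : CochainComplex C ℤ} (φ : K ⟶ L) (n : ℤ) :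
    K.truncLEShortComplex n ⟶ L.truncLEShortComplex n where
  τ₁ := truncLEMap φ n
  τ₂ := φ
  τ₃ := cokernel.map _ _ (truncLEMap φ n) φ (ιTruncLE_naturality φ n).symm
  comm₁₂ := ιTruncLE_naturality φ n
  comm₂₃ := (cokernel.π_desc _ _ _).symm

/-- The morphism induced on the kernels of the projections to the canonical truncations `≥ n`. -/
noncomputable abbrev truncGEShortComplexMap {K L : CochainComplex C ℤ} (φ : K ⟶ L) (n : ℤ) :
    K.truncGEShortComplex n ⟶ L.truncGEShortComplex n where
  τ₁ := kernel.map _ _ φ (truncGEMap φ n) (πTruncGE_naturality φ n)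
  τ₂ := φ
  τ₃ := truncGEMap φ n
  comm₁₂ := kernel.lift_ι _ _ _
  comm₂₃ := (πTruncGE_naturality φ n).symm

lemma isIso_truncLEShortComplexMap_τ₃ {K L : CochainComplex C ℤ} (φ : K ⟶ L) (n : ℤ)
    (h : ∀ j ≥ n, IsIso (φ.f j)) : IsIso (truncLEShortComplexMap φ n).τ₃ := by
  suffices ∀ i, IsIso ((truncLEShortComplexMap φ n).τ₃.f i) from
    HomologicalComplex.Hom.isIso_of_components _
  intro i
  have hK := (K.shortExact_truncLEShortComplex n).map_of_exact
    (HomologicalComplex.eval C (.up ℤ) i)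
  have hL := (L.shortExact_truncLEShortComplex n).map_of_exact
    (HomologicalComplex.eval C (.up ℤ) i)
  obtain hi | hi := lt_or_ge i n
  · exact (hK.isIso_f_iff.1 (isIso_ιTruncLE_f n K i hi)).isIso
      (hL.isIso_f_iff.1 (isIso_ιTruncLE_f n L i hi)) _
  · let ψ := (HomologicalComplex.eval C (.up ℤ) i).mapShortComplex.map
      (truncLEShortComplexMap φ n)
    exact hK.isIso_τ₃ hL ψ (isIso_truncLEMap_f φ n i hi h) (h i hi)

lemma isIso_truncGEShortComplexMap_τ₁ {K L : CochainComplex C ℤ} (φ : K ⟶ L) (n : ℤ)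
    (h : ∀ j ≤ n, IsIso (φ.f j)) : IsIso (truncGEShortComplexMap φ n).τ₁ := by
  suffices ∀ i, IsIso ((truncGEShortComplexMap φ n).τ₁.f i) from
    HomologicalComplex.Hom.isIso_of_components _
  intro i
  have hK := (K.shortExact_truncGEShortComplex n).map_of_exact
    (HomologicalComplex.eval C (.up ℤ) i)
  have hL := (L.shortExact_truncGEShortComplex n).map_of_exact
    (HomologicalComplex.eval C (.up ℤ) i)
  obtain hi | hi := lt_or_ge n i
  · exact (hK.isIso_g_iff.1 (isIso_πTruncGE_f n K i hi)).isIso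
      (hL.isIso_g_iff.1 (isIso_πTruncGE_f n L i hi)) _
  · let ψ := (HomologicalComplex.eval C (.up ℤ) i).mapShortComplex.map
      (truncGEShortComplexMap φ n)
    exact hK.isIso_τ₁ hL ψ (h i hi) (isIso_truncGEMap_f φ n i hi h)

/-- In a short exact sequence of complexes whose first term is acyclic, the homology of the
other two terms agrees. -/
lemma nonempty_homology_iso_of_acyclic_X₁ {S : ShortComplex (CochainComplex C ℤ)}
    (hS : S.ShortExact) (h : S.X₁.Acyclic) (i : ℤ) :
    Nonempty (S.X₂.homology i ≅ S.X₃.homology i) := by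
  have h₁ (j : ℤ) := (HomologicalComplex.exactAt_iff_isZero_homology _ _).1 (h j)
  have : Mono (HomologicalComplex.homologyMap S.g i) :=
    (hS.homology_exact₂ i).mono_g ((h₁ i).eq_of_src _ _)
  have : Epi (HomologicalComplex.homologyMap S.g i) :=
    (hS.homology_exact₃ i (i + 1) rfl).epi_f ((h₁ (i + 1)).eq_of_tgt _ _)
  have := isIso_of_mono_of_epi (HomologicalComplex.homologyMap S.g i)
  exact ⟨asIso (HomologicalComplex.homologyMap S.g i)⟩

/-- In a short exact sequence of complexes whose middle term is acyclic, the homology of the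
other two terms agrees up to a shift. -/
noncomputable def homologyIsoOfAcyclicX₂ {S : ShortComplex (CochainComplex C ℤ)}
    (hS : S.ShortExact) (h : S.X₂.Acyclic) (i j : ℤ) (hij : i + 1 = j) :
    S.X₃.homology i ≅ S.X₁.homology j :=
  hS.δIso i j hij ((HomologicalComplex.exactAt_iff_isZero_homology _ _).1 (h i))
    ((HomologicalComplex.exactAt_iff_isZero_homology _ _).1 (h j))

end CochainComplex

namespace RComplex

open CochainComplex CochainComplex.HomComplex
open scoped ModuleCat.Algebra

variable (𝕜 : Type w) [CommRing 𝕜] {R : Type u} [Ring R] [Algebra 𝕜 R]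

/-- If `N ⟶ I` is a quasi-isomorphism, `I ⟶ U` is an isomorphism in large cohomological degrees
and `U` and `Hom(T, I)` are acyclic, then `H^i Hom(T, U) ≅ H^{i+1} Hom(T, N)`. -/
lemma nonempty_homology_iso_right (T : RComplex R) [∀ i, Projective (T.X i)]
    {N I U : RComplex R} (f : N ⟶ I) [QuasiIso f] (g : I ⟶ U) (n : ℤ) [N.IsStrictlyLE n]
    (hg : ∀ j ≥ n, IsIso (g.f j)) (hU : U.Acyclic) (hI : (homComplex 𝕜 T I).Acyclic)
    (i j : ℤ) (hij : i + 1 = j) :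
    Nonempty ((homComplex 𝕜 T U).homology i ≅ (homComplex 𝕜 T N).homology j) := by
  obtain ⟨e₁⟩ := nonempty_homology_iso_of_acyclic_X₁
    (shortExact_postcomp 𝕜 T (U.shortExact_truncLEShortComplex n))
    (homComplex_acyclic_of_projective 𝕜 T (U.truncLE n) n (hU.truncLE _)) i
  have := isIso_truncLEShortComplexMap_τ₃ g n hg
  let e₂ := postcompIso 𝕜 T (asIso (truncLEShortComplexMap g n).τ₃)
  let e₃ := homologyIsoOfAcyclicX₂
    (shortExact_postcomp 𝕜 T (I.shortExact_truncLEShortComplex n)) hI i j hij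
  have : QuasiIso (truncLEMap f n) := (quasiIso_truncLEMap_iff f n).2 fun _ _ => inferInstance
  have : (mappingCone (truncLEMap f n)).IsStrictlyLE n := by
    rw [isStrictlyLE_iff]
    exact fun k hk => isZero_mappingCone_X _ k (isZero_of_isStrictlyLE _ n _)
      (isZero_of_isStrictlyLE _ n _)
  let e₄ := homologyIsoOfAcyclicX₂
    (shortExact_postcomp 𝕜 T (shortExact_triangleRotateShortComplex (truncLEMap f n)))
    (homComplex_acyclic_of_projective 𝕜 T (mappingCone (truncLEMap f n)) n
      (acyclic_mappingCone (truncLEMap f n))) i j hij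
  let e₅ := homologyShiftRightIso 𝕜 T (N.truncLE n) i j hij
  let e₆ := postcompIso 𝕜 T (asIso (N.ιTruncLE n))
  exact ⟨e₁ ≪≫ (HomologicalComplex.homologyFunctor _ _ i).mapIso e₂.symm ≪≫ e₃ ≪≫ e₄.symm ≪≫
    e₅ ≪≫ (HomologicalComplex.homologyFunctor _ _ j).mapIso e₆⟩

/-- If `P ⟶ M` is a quasi-isomorphism, `T ⟶ P` is an isomorphism in small cohomological degrees
and `T` and `Hom(P, U)` are acyclic, then `H^i Hom(T, U) ≅ H^{i+1} Hom(M, U)`. -/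
lemma nonempty_homology_iso_left (U : RComplex R) [∀ i, Injective (U.X i)]
    {T P M : RComplex R} (f : T ⟶ P) (g : P ⟶ M) [QuasiIso g] (n : ℤ) [M.IsStrictlyGE n]
    (hf : ∀ j ≤ n, IsIso (f.f j)) (hT : T.Acyclic) (hP : (homComplex 𝕜 P U).Acyclic)
    (i j : ℤ) (hij : i + 1 = j) :
    Nonempty ((homComplex 𝕜 T U).homology i ≅ (homComplex 𝕜 M U).homology j) := by
  obtain ⟨e₁⟩ := nonempty_homology_iso_of_acyclic_X₁
    (shortExact_precomp 𝕜 (T.shortExact_truncGEShortComplex n) U)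
    (homComplex_acyclic_of_injective 𝕜 (T.truncGE n) U n (hT.truncGE _)) i
  have := isIso_truncGEShortComplexMap_τ₁ f n hf
  let e₂ := precompIso 𝕜 (asIso (truncGEShortComplexMap f n).τ₁) U
  let e₃ := homologyIsoOfAcyclicX₂
    (shortExact_precomp 𝕜 (P.shortExact_truncGEShortComplex n) U) hP i j hij
  have : QuasiIso (truncGEMap g n) := (quasiIso_truncGEMap_iff g n).2 fun _ _ => inferInstance
  have : (mappingCone (truncGEMap g n)).IsStrictlyGE (n - 1) := by
    rw [isStrictlyGE_iff]
    exact fun k hk => isZero_mappingCone_X _ k (isZero_of_isStrictlyGE _ n _)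
      (isZero_of_isStrictlyGE _ n _)
  let e₄ := homologyIsoOfAcyclicX₂
    (shortExact_precomp 𝕜 (shortExact_triangleRotateShortComplex (truncGEMap g n)) U)
    (homComplex_acyclic_of_injective 𝕜 (mappingCone (truncGEMap g n)) U (n - 1)
      (acyclic_mappingCone (truncGEMap g n)))
    j (j + 1) rfl
  let e₅ := homologyShiftLeftIso 𝕜 (P.truncGE n) U j (j + 1) rfl
  let e₆ := precompIso 𝕜 (asIso (M.πTruncGE n)) U
  exact ⟨e₁ ≪≫ (HomologicalComplex.homologyFunctor _ _ i).mapIso e₂.symm ≪≫ e₃ ≪≫ e₅ ≪≫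
    e₄.symm ≪≫ (HomologicalComplex.homologyFunctor _ _ j).mapIso e₆⟩

end RComplex

theorem mainTheorem4 (𝕜 : Type w) [CommRing 𝕜] {R : Type u} [Ring R] [Algebra 𝕜 R]
    (M N : RComplex R) (hM : M.BoundedAbove) (hN : N.BoundedBelow)
    (C : M.CompleteProjectiveResolution) (D : N.CompleteInjectiveResolution) (i : ℤ) :
    Nonempty (RComplex.tateExt 𝕜 C N i ≅ (RComplex.homComplex 𝕜 M D.U).homology i) := by
  have (k : ℤ) : Projective (C.T.X k) :=
    (IsProjective.iff_projective _).1 (C.totallyAcyclic.projective k)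
  have (k : ℤ) : Injective (D.U.X k) :=
    (Module.injective_iff_injective_object R _).1 (D.totallyAcyclic.injective k)
  have := C.quasiIso
  have := D.quasiIso
  obtain ⟨s, hs⟩ := hM
  obtain ⟨t, ht⟩ := hN
  obtain ⟨a, ha⟩ := C.isIso_τ
  obtain ⟨b, hb⟩ := D.isIso_υ
  have : M.IsStrictlyGE (-max s a) := (CochainComplex.isStrictlyGE_iff _ _).2 fun k hk => by
    simpa using hs (-k) (by omega)
  have : N.IsStrictlyLE (-min t b) := (CochainComplex.isStrictlyLE_iff _ _).2 fun k hk => by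
    simpa using ht (-k) (by omega)
  obtain ⟨e₁⟩ := RComplex.nonempty_homology_iso_right 𝕜 C.T D.ι D.υ (-min t b)
    (fun k hk => neg_neg k ▸ hb (-k) (by omega)) D.totallyAcyclic.acyclic
    (RComplex.homComplex_acyclic_of_acyclic 𝕜
      (D.semiinjective.acyclic_hom _ C.totallyAcyclic.acyclic)) (i - 1) i (by omega)
  obtain ⟨e₂⟩ := RComplex.nonempty_homology_iso_left 𝕜 D.U C.τ C.π (-max s a)
    (fun k hk => neg_neg k ▸ ha (-k) (by omega)) C.totallyAcyclic.acyclic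
    (RComplex.homComplex_acyclic_of_acyclic 𝕜
      (C.semiprojective.acyclic_hom _ D.totallyAcyclic.acyclic)) (i - 1) i (by omega)
  exact ⟨e₁.symm ≪≫ e₂⟩
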